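/- All graphs are finite and simple. A \emph{plane graph} is a connected graph $G=(V,E)$ together with an embedding in the sphere, given combinatorially: for every vertex a cyclic order of the edges around it, such that the set $\Phi$ of faces (the closed facial walks determined by these cyclic orders) satisfies Euler's formula $|V|-|E|+|\Phi|=2$. The length of a face is the length of its facial walk, and an \emph{$\ell$-face} is a face of length $\ell$. Two distinct faces are \emph{neighbors} if they share an edge, and the \emph{facial distance} of two faces is their distance in the graph whose vertices are the faces and whose edges join neighboring faces. A \emph{fullerene graph} is a cubic plane graph each of whose faces has length $5$ or $6$. For a positive integer $k$, a \emph{$k$-drum} is a fullerene graph that has two $6$-faces $F$ and $F'$ at facial distance $k+1$ such that each of $F$ and $F'$ is a neighbor of six $5$-faces and these twelve $5$-faces are all distinct. A graph is \emph{exact square $3$-colorable} if its vertices can be colored with three colors so that any two vertices at distance exactly $2$ receive distinct colors. \textbf{Theorem.} A fullerene graph is exact square $3$-colorable if and only if it is a $k$-drum for some positive integer $k$. -/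

import Mathlib

/-- The exact distance-`p` power of `G`: two distinct vertices are joined when their distance in
`G` is exactly `p`. (`edist` is `⊤` between different components.) -/
def SimpleGraph.exactPower {V : Type*} (G : SimpleGraph V) (p : ℕ) : SimpleGraph V where
  Adj u v := u ≠ v ∧ G.edist u v = p
  symm := ⟨fun _ _ h => ⟨h.1.symm, by rw [SimpleGraph.edist_comm]; exact h.2⟩⟩
  loopless := ⟨fun _ h => h.1 rfl⟩

/-- `G` is exact square `n`-colorable: its vertices can be colored with `n` colors such that any
two vertices at distance exactly two receive distinct colors. -/
def SimpleGraph.ExactSquareColorable {V : Type*} (G : SimpleGraph V) (n : ℕ) : Prop :=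
  (G.exactPower 2).Colorable n

/-- A combinatorial embedding (rotation system) of `G` in an oriented surface: a permutation of
the darts of `G` whose restriction to the darts leaving any given vertex is one cycle, namely
the cyclic order in which these darts appear around the vertex. -/
structure RotationSystem {V : Type*} (G : SimpleGraph V) where
  rot : Equiv.Perm G.Dart
  fst_rot : ∀ d, (rot d).fst = d.fst
  sameCycle_rot : ∀ d e : G.Dart, d.fst = e.fst → rot.SameCycle d e

namespace RotationSystem

variable {V : Type*} {G : SimpleGraph V} (M : RotationSystem G)

/-- Facial walks: having traversed the dart `d` from `u` to `v`, continue along the dart that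
follows `(v, u)` in the cyclic order around `v`. -/
def facePerm : Equiv.Perm G.Dart :=
  (Function.Involutive.toPerm SimpleGraph.Dart.symm SimpleGraph.Dart.symm_involutive).trans M.rot

/-- A face is an orbit of darts under the facial walk. -/
def Face : Type _ := Quotient (Equiv.Perm.SameCycle.setoid M.facePerm)

/-- The face whose boundary walk traverses the dart `d`. -/
def faceOf (d : G.Dart) : M.Face := Quotient.mk (Equiv.Perm.SameCycle.setoid M.facePerm) d

/-- The length of a face is the length of its boundary walk (an edge that is traversed twice
counts twice). -/
noncomputable def faceLength (F : M.Face) : ℕ := Nat.card {d : G.Dart // M.faceOf d = F}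

/-- The adjacency graph of the faces: two distinct faces are neighbors when they share an edge. -/
def faceGraph : SimpleGraph M.Face where
  Adj A B := A ≠ B ∧ ∃ d : G.Dart, M.faceOf d = A ∧ M.faceOf d.symm = B
  symm := ⟨fun _ _ h => ⟨h.1.symm, by
    obtain ⟨d, hA, hB⟩ := h.2
    exact ⟨d.symm, hB, by rw [SimpleGraph.Dart.symm_symm]; exact hA⟩⟩⟩
  loopless := ⟨fun _ h => h.1 rfl⟩

/-- The embedded graph is a plane graph: it is connected and the surface is a sphere, that is,
Euler's formula `|V| - |E| + |F| = 2` holds. (Used for finite graphs with at least one edge.) -/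
def IsPlane : Prop :=
  G.Connected ∧ Nat.card V + Nat.card M.Face = Nat.card G.edgeSet + 2

/-- A fullerene graph: a cubic plane graph each of whose faces has length 5 or 6. -/
structure IsFullerene : Prop where
  plane : M.IsPlane
  cubic : ∀ v, (G.neighborSet v).ncard = 3
  faceLength_eq : ∀ F, M.faceLength F = 5 ∨ M.faceLength F = 6

/-- The set of 5-faces that are neighbors of the face `F`. -/
def fiveFaceNeighbors (F : M.Face) : Set M.Face :=
  {A | M.faceGraph.Adj F A ∧ M.faceLength A = 5}

/-- A `k`-drum: a fullerene graph with two 6-faces `F` and `F'` at facial distance `k + 1`, each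
neighboring six 5-faces, such that these twelve 5-faces are distinct. -/
def IsDrum (k : ℕ) : Prop :=
  M.IsFullerene ∧ ∃ F F' : M.Face,
    M.faceLength F = 6 ∧ M.faceLength F' = 6 ∧
    (M.fiveFaceNeighbors F).ncard = 6 ∧ (M.fiveFaceNeighbors F').ncard = 6 ∧
    Disjoint (M.fiveFaceNeighbors F) (M.fiveFaceNeighbors F') ∧
    M.faceGraph.edist F F' = ((k + 1 : ℕ) : ℕ∞)

end RotationSystem

/-! ### Orbits of a permutation of a finite type -/

/-! A fullerene graph has no triangles, so the relevant colorings are those that are injective on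
every neighborhood (`IsFullerene.exactSquareColorable_iff`).

From a coloring to a drum: joining the vertices of a pentagon that are two apart gives a 5-cycle,
which forces the pattern A, B, B, C, A and singles out one side, the base, opposite to the vertex
colored C. Propagating colors shows that the next side of the face across the base is the base of
another pentagon (`IsFullerene.isBase_next`). So that face is surrounded by pentagons, each attached
along its base, and it is a hexagon. By Euler's formula there are twelve pentagons, and bases are
unique, so a second such hexagon exists, with six other pentagons around it.

From a drum to a coloring: increments in `ZMod 3` on the darts integrate to a coloring once they
cancel around every face, because the sphere has no first cohomology (`exists_potential`). Away from
the two hexagons (caps) the graph looks like the honeycomb: vertices carry alternating signs, and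
edges carry one of three directions, shifting by one at each step around a vertex
(`IsCapSet.exists_isDirection`). All edges at a cap share one direction. If both caps have the same
direction `a`, the increments sign × (direction − `a`), replaced by ± sign along the caps, cancel
around each face and are distinct at each vertex (`IsDirection.exists_nbrInjective`).

The caps do agree (`IsDirection.eq_of_caps`). Otherwise, count the darts off the caps that have the
direction of the second cap, each with the sign of its tail. Reversal flips the sign, so the total
is zero; but counted by faces, only the pentagons at the first cap contribute, all by the same ±1.
-/

theorem Equiv.Perm.sameCycle_iff_exists_iterate {α : Type*} [Finite α] (f : Equiv.Perm α)
    (x y : α) : f.SameCycle x y ↔ ∃ i < Function.minimalPeriod f x, f^[i] x = y := by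
  constructor
  · intro h
    obtain ⟨n, hn⟩ := h.exists_nat_pow_eq
    have hpos : 0 < Function.minimalPeriod f x :=
      Function.minimalPeriod_pos_of_mem_periodicPts
        (Function.Injective.mem_periodicPts f.injective x)
    refine ⟨n % Function.minimalPeriod f x, Nat.mod_lt _ hpos, ?_⟩
    rw [Function.iterate_mod_minimalPeriod_eq, Equiv.Perm.iterate_eq_pow, hn]
  · rintro ⟨i, -, rfl⟩
    exact ⟨i, by rw [Equiv.Perm.iterate_eq_pow, zpow_natCast]⟩

theorem Equiv.Perm.card_sameCycle {α : Type*} [Finite α] (f : Equiv.Perm α) (x : α) :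
    Nat.card {y // f.SameCycle x y} = Function.minimalPeriod f x := by
  have e : {y | f.SameCycle x y}
      = (fun i => f^[i] x) '' Set.Iio (Function.minimalPeriod f x) := by
    ext y
    simp [f.sameCycle_iff_exists_iterate]
  change Nat.card ({y | f.SameCycle x y} : Set α) = _
  rw [Nat.card_coe_set_eq, e, Function.iterate_injOn_Iio_minimalPeriod.ncard_image]
  simp [Set.ncard_eq_toFinset_card']

theorem Function.minimalPeriod_ne_of_lt {α : Type*} {f : α → α} {x : α} {i : ℕ} (hi : 0 < i)
    (h : i < Function.minimalPeriod f x) : f^[i] x ≠ x := fun h' =>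
  absurd (Function.IsPeriodicPt.minimalPeriod_le hi h') (by omega)

instance SimpleGraph.finite_dart {V : Type*} [Finite V] (G : SimpleGraph V) : Finite G.Dart :=
  Finite.of_injective _ SimpleGraph.Dart.toProd_injective

namespace RotationSystem

variable {V : Type*} {G : SimpleGraph V} (M : RotationSystem G)

/-! ### Darts, vertices and faces -/

theorem facePerm_apply (d : G.Dart) : M.facePerm d = M.rot d.symm := rfl

theorem facePerm_symm (d : G.Dart) : M.facePerm d.symm = M.rot d := by
  rw [facePerm_apply, SimpleGraph.Dart.symm_symm]

theorem fst_facePerm (d : G.Dart) : (M.facePerm d).fst = d.snd := M.fst_rot _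

theorem fst_iterate_rot (i : ℕ) (d : G.Dart) : (M.rot^[i] d).fst = d.fst := by
  induction i with
  | zero => rfl
  | succ n ih => rw [Function.iterate_succ_apply', fst_rot, ih]

theorem faceOf_eq_iff {d e : G.Dart} : M.faceOf d = M.faceOf e ↔ M.facePerm.SameCycle d e :=
  Quotient.eq (r := Equiv.Perm.SameCycle.setoid M.facePerm)

theorem faceOf_facePerm (d : G.Dart) : M.faceOf (M.facePerm d) = M.faceOf d :=
  M.faceOf_eq_iff.2 (Equiv.Perm.sameCycle_apply_left.2 (Equiv.Perm.SameCycle.refl _ _))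

theorem faceOf_iterate (i : ℕ) (d : G.Dart) : M.faceOf (M.facePerm^[i] d) = M.faceOf d := by
  induction i with
  | zero => rfl
  | succ n ih => rw [Function.iterate_succ_apply', faceOf_facePerm, ih]

theorem faceOf_rot (d : G.Dart) : M.faceOf (M.rot d) = M.faceOf d.symm := by
  rw [← facePerm_symm, faceOf_facePerm]

theorem faceOf_surjective : Function.Surjective M.faceOf := Quotient.mk_surjective

instance finite_face [Finite V] : Finite M.Face :=
  Finite.of_surjective _ M.faceOf_surjective

section Finite

variable [Finite V]

theorem minimalPeriod_facePerm (d : G.Dart) :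
    Function.minimalPeriod M.facePerm d = M.faceLength (M.faceOf d) := by
  rw [← Equiv.Perm.card_sameCycle, faceLength]
  simp_rw [M.faceOf_eq_iff, Equiv.Perm.sameCycle_comm]

theorem iterate_faceLength (d : G.Dart) : M.facePerm^[M.faceLength (M.faceOf d)] d = d := by
  rw [← minimalPeriod_facePerm]
  exact Function.iterate_minimalPeriod

theorem iterate_ne_of_lt {d : G.Dart} {i : ℕ} (h0 : 0 < i) (h : i < M.faceLength (M.faceOf d)) :
    M.facePerm^[i] d ≠ d :=
  Function.minimalPeriod_ne_of_lt h0 (by rwa [minimalPeriod_facePerm])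

theorem faceOf_eq_iff_exists {d e : G.Dart} :
    M.faceOf d = M.faceOf e ↔ ∃ i < M.faceLength (M.faceOf d), M.facePerm^[i] d = e := by
  rw [M.faceOf_eq_iff, Equiv.Perm.sameCycle_iff_exists_iterate, minimalPeriod_facePerm]

open Classical in
theorem sum_face [Fintype G.Dart] {A : Type*} [AddCommMonoid A] (g : G.Dart → A) (d : G.Dart) :
    ∑ x with M.faceOf x = M.faceOf d, g x
      = ∑ i ∈ Finset.range (M.faceLength (M.faceOf d)), g (M.facePerm^[i] d) := by
  symm
  refine Finset.sum_nbij (fun i => M.facePerm^[i] d) ?_ ?_ ?_ (fun _ _ => rfl)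
  · intro i _
    simp [faceOf_iterate]
  · intro i hi j hj h
    refine Function.iterate_injOn_Iio_minimalPeriod (f := M.facePerm) (x := d) ?_ ?_ h
    · simpa [minimalPeriod_facePerm] using hi
    · simpa [minimalPeriod_facePerm] using hj
  · intro x hx
    obtain ⟨i, hi, h⟩ := M.faceOf_eq_iff_exists.1 (by simpa using hx : M.faceOf x = _).symm
    exact ⟨i, by simpa using hi, h⟩

omit [Finite V] in
theorem card_darts_at (v : V) : Nat.card {d : G.Dart // d.fst = v} = (G.neighborSet v).ncard := by
  rw [← Nat.card_coe_set_eq]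
  refine Nat.card_congr
    { toFun := fun d => ⟨d.1.snd, by obtain ⟨⟨p, h⟩, rfl⟩ := d; exact h⟩
      invFun := fun w => ⟨⟨(v, w.1), w.2⟩, rfl⟩
      left_inv := ?_
      right_inv := fun w => rfl }
  rintro ⟨⟨⟨a, b⟩, h⟩, rfl⟩
  rfl

section Cubic

variable (hc : ∀ v, (G.neighborSet v).ncard = 3)
include hc

theorem minimalPeriod_rot (d : G.Dart) : Function.minimalPeriod M.rot d = 3 := by
  rw [← Equiv.Perm.card_sameCycle, ← hc d.fst, ← card_darts_at]
  refine Nat.card_congr (Equiv.subtypeEquivRight fun e => ⟨fun h => ?_, fun h => ?_⟩)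
  · obtain ⟨i, -, rfl⟩ := (M.rot.sameCycle_iff_exists_iterate _ _).1 h
    exact M.fst_iterate_rot i d
  · exact M.sameCycle_rot _ _ h.symm

theorem rot_rot_rot (d : G.Dart) : M.rot (M.rot (M.rot d)) = d := by
  have := Function.iterate_minimalPeriod (f := M.rot) (x := d)
  rwa [M.minimalPeriod_rot hc] at this

theorem rot_ne (d : G.Dart) : M.rot d ≠ d :=
  Function.minimalPeriod_ne_of_lt (i := 1) (by omega) (by rw [M.minimalPeriod_rot hc]; omega)

theorem rot_rot_ne (d : G.Dart) : M.rot (M.rot d) ≠ d :=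
  Function.minimalPeriod_ne_of_lt (i := 2) (by omega) (by rw [M.minimalPeriod_rot hc]; omega)

theorem eq_or_eq_rot_of_fst_eq {d e : G.Dart} (h : d.fst = e.fst) :
    e = d ∨ e = M.rot d ∨ e = M.rot (M.rot d) := by
  obtain ⟨i, hi, rfl⟩ := (M.rot.sameCycle_iff_exists_iterate _ _).1 (M.sameCycle_rot d e h)
  rw [M.minimalPeriod_rot hc] at hi
  interval_cases i
  · exact .inl rfl
  · exact .inr (.inl rfl)
  · exact .inr (.inr rfl)

theorem facePerm_symm_rot_rot (d : G.Dart) : M.facePerm (M.rot (M.rot d)).symm = d := by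
  rw [facePerm_symm, M.rot_rot_rot hc]

end Cubic

end Finite

/-! ### Vanishing of the first cohomology of the sphere -/

section Potential

variable (K : Type*) [Field K]

/-- Antisymmetric functions on the darts. -/
def antisymm (G : SimpleGraph V) : Submodule K (G.Dart → K) where
  carrier := {a | ∀ d, a d.symm = -a d}
  add_mem' := fun ha hb d => by simp [ha d, hb d, add_comm]
  zero_mem' := fun d => by simp
  smul_mem' := fun c a ha d => by simp [ha d]

/-- The coboundary of a function on the vertices. -/
def coboundary (G : SimpleGraph V) : (V → K) →ₗ[K] antisymm K G where
  toFun g := ⟨fun d => g d.snd - g d.fst, fun d => by simp⟩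
  map_add' g h := by ext d; simp; ring
  map_smul' c g := by ext d; simp; ring

open Classical in
/-- The sum of an antisymmetric function over each facial walk. -/
noncomputable def faceSum [Fintype G.Dart] : antisymm K G →ₗ[K] (M.Face → K) where
  toFun a F := ∑ x with M.faceOf x = F, a.1 x
  map_add' a b := by ext F; simp [Finset.sum_add_distrib]
  map_smul' c a := by ext F; simp [Finset.mul_sum]

/-- An antisymmetric function is determined by its values on one orientation of each edge. -/
theorem finrank_antisymm_le [Finite V] :
    Module.finrank K (antisymm K G) ≤ Nat.card G.edgeSet := by
  classical
  have := Fintype.ofFinite V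
  have := Fintype.ofFinite G.edgeSet
  have hr : ∀ e : G.edgeSet, ∃ d : G.Dart, d.edge = e.1 := by
    rintro ⟨e, he⟩
    induction e with
    | _ a b => exact ⟨⟨(a, b), he⟩, rfl⟩
  choose r hr using hr
  let L : antisymm K G →ₗ[K] (G.edgeSet → K) :=
    { toFun := fun a e => a.1 (r e)
      map_add' := fun a b => rfl
      map_smul' := fun a b => rfl }
  have hL : Function.Injective L := by
    rw [← LinearMap.ker_eq_bot, LinearMap.ker_eq_bot']
    intro a ha
    ext d
    have h := congrFun ha ⟨d.edge, d.edge_mem⟩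
    change a.1 (r _) = 0 at h
    rcases (SimpleGraph.dart_edge_eq_iff _ _).1 (hr ⟨d.edge, d.edge_mem⟩) with h' | h'
    · rw [h'] at h; exact h
    · rw [h', a.2 d] at h
      simpa using h
  calc Module.finrank K (antisymm K G) ≤ Module.finrank K (G.edgeSet → K) :=
        LinearMap.finrank_le_finrank_of_injective hL
    _ = Nat.card G.edgeSet := by simp

/-- On a connected graph only constants have zero coboundary. -/
theorem card_le_finrank_coboundary [Finite V] (hG : G.Connected) :
    Nat.card V ≤ Module.finrank K (LinearMap.range (coboundary K G)) + 1 := by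
  have := Fintype.ofFinite V
  obtain ⟨v⟩ := hG.nonempty
  have h1 := LinearMap.finrank_range_add_finrank_ker (coboundary K G)
  have h2 : Module.finrank K (LinearMap.ker (coboundary K G)) ≤ 1 := by
    let L : LinearMap.ker (coboundary K G) →ₗ[K] K :=
      (LinearMap.proj v).comp (Submodule.subtype _)
    have hL : Function.Injective L := by
      rw [← LinearMap.ker_eq_bot, LinearMap.ker_eq_bot']
      rintro ⟨g, hg⟩ h0
      have hstep : ∀ a b, G.Adj a b → g a = g b := fun a b hab => by
        have := congrArg (fun z => z.1 ⟨(a, b), hab⟩) (LinearMap.mem_ker.1 hg)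
        exact (sub_eq_zero.1 this).symm
      ext w
      change g v = 0 at h0
      change g w = 0
      rw [← h0]
      obtain ⟨p⟩ := hG.preconnected w v
      induction p with
      | nil => rfl
      | cons h p ih => rw [hstep _ _ h, ih h0]
    simpa using LinearMap.finrank_le_finrank_of_injective hL
  have h3 : Module.finrank K (V → K) = Nat.card V := by simp
  omega

/-- A property of faces that passes to neighboring faces holds for all faces. -/
theorem face_induction [Finite V] (hG : G.Connected) {p : M.Face → Prop} (d : G.Dart)
    (h0 : p (M.faceOf d)) (hs : ∀ d : G.Dart, p (M.faceOf d) → p (M.faceOf d.symm)) (F : M.Face) :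
    p F := by
  have hrot : ∀ x : G.Dart, p (M.faceOf x) → p (M.faceOf (M.rot x)) := fun x hx => by
    rw [faceOf_rot]; exact hs _ hx
  have hv : ∀ x y : G.Dart, x.fst = y.fst → p (M.faceOf x) → p (M.faceOf y) := fun x y h hx => by
    obtain ⟨i, -, rfl⟩ := (M.rot.sameCycle_iff_exists_iterate _ _).1 (M.sameCycle_rot x y h)
    clear h
    induction i with
    | zero => exact hx
    | succ n ih => rw [Function.iterate_succ_apply']; exact hrot _ ih
  have key : ∀ (a b : V) (q : G.Walk a b), (∀ x : G.Dart, x.fst = a → p (M.faceOf x)) →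
      ∀ x : G.Dart, x.fst = b → p (M.faceOf x) := by
    intro a b q
    induction q with
    | nil => exact id
    | @cons u v w h q ih =>
      intro hu
      refine ih fun x hx => ?_
      exact hv (SimpleGraph.Dart.symm ⟨(u, v), h⟩) x hx.symm (hs _ (hu _ rfl))
  obtain ⟨e, rfl⟩ := M.faceOf_surjective F
  obtain ⟨q⟩ := hG.preconnected d.fst e.fst
  exact key _ _ q (fun x hx => hv d x hx.symm h0) e rfl

/-- The dual of the previous rank bound: an edge maps to the difference of the indicators of its two
faces, so by connectedness of the dual a single indicator completes the image to the whole space. -/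
theorem card_face_le_finrank_faceSum [Finite V] [Fintype G.Dart] (hG : G.Connected) :
    Nat.card M.Face ≤ Module.finrank K (LinearMap.range (M.faceSum K)) + 1 := by
  classical
  have := Fintype.ofFinite M.Face
  rcases isEmpty_or_nonempty M.Face with hF | ⟨⟨F₀⟩⟩
  · simp
  obtain ⟨d₀, rfl⟩ := M.faceOf_surjective F₀
  let W := LinearMap.range (M.faceSum K) ⊔ K ∙ (Pi.single (M.faceOf d₀) 1 : M.Face → K)
  have hW : ∀ F, (Pi.single F 1 : M.Face → K) ∈ W := by
    refine M.face_induction hG d₀ ?_ ?_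
    · exact Submodule.mem_sup_right (Submodule.mem_span_singleton_self _)
    · intro d hd
      let a : antisymm K G := ⟨Pi.single d 1 - Pi.single d.symm 1, fun x => by
        have h1 : x.symm = d ↔ x = d.symm := by
          constructor <;> rintro rfl <;> simp
        simp [Pi.single_apply, h1, SimpleGraph.Dart.symm_involutive.injective.eq_iff]⟩
      have ha : M.faceSum K a = Pi.single (M.faceOf d) 1 - Pi.single (M.faceOf d.symm) 1 := by
        ext F
        change ∑ x with M.faceOf x = F, ((Pi.single d 1 : G.Dart → K) x
          - (Pi.single d.symm 1 : G.Dart → K) x) = _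
        simp [Finset.sum_sub_distrib, Pi.single_apply, eq_comm (a := F)]
      have h2 : M.faceSum K a ∈ W := Submodule.mem_sup_left ⟨a, rfl⟩
      have := W.sub_mem hd h2
      rwa [ha, sub_sub_cancel] at this
  have htop : W = ⊤ := by
    rw [eq_top_iff, ← (Pi.basisFun K M.Face).span_eq, Submodule.span_le]
    rintro _ ⟨F, rfl⟩
    simpa using hW F
  have h1 := Submodule.finrank_add_le_finrank_add_finrank (LinearMap.range (M.faceSum K))
    (K ∙ (Pi.single (M.faceOf d₀) 1 : M.Face → K))
  have h2 : Module.finrank K W = Nat.card M.Face := by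
    rw [htop, finrank_top]; simp
  have h3 := finrank_span_le_card (R := K) ({Pi.single (M.faceOf d₀) 1} : Set (M.Face → K))
  simp only [Set.toFinset_singleton, Finset.card_singleton] at h3
  change Module.finrank K W ≤ _ at h1
  omega

variable {K} in
/-- On a plane graph every antisymmetric function on the darts whose sum over each facial walk
vanishes is a coboundary. -/
theorem exists_potential [Finite V] (hM : M.IsPlane) (a : G.Dart → K)
    (hanti : ∀ d, a d.symm = -a d)
    (hface : ∀ d, ∑ i ∈ Finset.range (M.faceLength (M.faceOf d)), a (M.facePerm^[i] d) = 0) :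
    ∃ g : V → K, ∀ d, a d = g d.snd - g d.fst := by
  classical
  have := Fintype.ofFinite V
  have := Fintype.ofFinite G.Dart
  obtain ⟨hG, hE⟩ := hM
  have hle : LinearMap.range (coboundary K G) ≤ LinearMap.ker (M.faceSum K) := by
    rintro _ ⟨g, rfl⟩
    rw [LinearMap.mem_ker]
    ext F
    obtain ⟨d, rfl⟩ := M.faceOf_surjective F
    change ∑ x with M.faceOf x = M.faceOf d, (g x.snd - g x.fst) = 0
    rw [M.sum_face]
    have : ∀ i, g (M.facePerm^[i] d).snd - g (M.facePerm^[i] d).fst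
        = g (M.facePerm^[i + 1] d).fst - g (M.facePerm^[i] d).fst := fun i => by
      rw [Function.iterate_succ_apply', fst_facePerm]
    simp_rw [this]
    rw [Finset.sum_range_sub (fun i => g (M.facePerm^[i] d).fst), iterate_faceLength]
    simp
  have h1 := LinearMap.finrank_range_add_finrank_ker (M.faceSum K)
  have h2 := finrank_antisymm_le (G := G) K
  have h3 := card_le_finrank_coboundary K hG
  have h4 := M.card_face_le_finrank_faceSum K hG
  -- The three rank bounds and Euler's formula leave the kernel dimension at most |V| − 1, which the
  -- coboundaries already reach.
  have heq := Submodule.eq_of_le_of_finrank_le hle (by omega)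
  have hmem : (⟨a, hanti⟩ : antisymm K G) ∈ LinearMap.range (coboundary K G) := by
    rw [heq, LinearMap.mem_ker]
    ext F
    obtain ⟨d, rfl⟩ := M.faceOf_surjective F
    change ∑ x with M.faceOf x = M.faceOf d, a x = 0
    rw [M.sum_face, hface]
  obtain ⟨g, hg⟩ := hmem
  exact ⟨g, fun d => (congrArg (fun z => z.1 d) hg).symm⟩

end Potential

/-! ### Fullerene graphs: darts per face, triangles, and the number of pentagons -/

section Fullerene

variable [Finite V]

theorem iterate_five {d : G.Dart} (h : M.faceLength (M.faceOf d) = 5) :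
    M.facePerm (M.facePerm (M.facePerm (M.facePerm (M.facePerm d)))) = d := by
  have := M.iterate_faceLength d
  rwa [h] at this

theorem iterate_six {d : G.Dart} (h : M.faceLength (M.faceOf d) = 6) :
    M.facePerm (M.facePerm (M.facePerm (M.facePerm (M.facePerm (M.facePerm d))))) = d := by
  have := M.iterate_faceLength d
  rwa [h] at this

theorem eq_of_faceOf_eq_of_five {d e : G.Dart} (h : M.faceLength (M.faceOf d) = 5)
    (he : M.faceOf d = M.faceOf e) :
    e = d ∨ e = M.facePerm d ∨ e = M.facePerm (M.facePerm d) ∨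
      e = M.facePerm (M.facePerm (M.facePerm d)) ∨
      e = M.facePerm (M.facePerm (M.facePerm (M.facePerm d))) := by
  obtain ⟨i, hi, rfl⟩ := M.faceOf_eq_iff_exists.1 he
  rw [h] at hi
  interval_cases i <;> simp

theorem card_dart_eq_sum_faceLength [Fintype M.Face] :
    Nat.card G.Dart = ∑ F : M.Face, M.faceLength F := by
  classical
  have := Fintype.ofFinite G.Dart
  rw [Nat.card_eq_fintype_card, ← Finset.card_univ,
    Finset.card_eq_sum_card_fiberwise (f := M.faceOf) (t := Finset.univ) (fun _ _ => by simp)]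
  refine Finset.sum_congr rfl fun F _ => ?_
  rw [faceLength, Nat.card_eq_fintype_card, Fintype.card_subtype]

theorem card_dart_eq_two_mul : Nat.card G.Dart = 2 * Nat.card G.edgeSet := by
  classical
  have := Fintype.ofFinite V
  rw [Nat.card_eq_fintype_card, Nat.card_eq_fintype_card, ← SimpleGraph.edgeFinset_card,
    ← SimpleGraph.dart_card_eq_twice_card_edges]

theorem card_dart_of_cubic (hc : ∀ v, (G.neighborSet v).ncard = 3) :
    Nat.card G.Dart = 3 * Nat.card V := by
  classical
  have := Fintype.ofFinite V
  have := Fintype.ofFinite G.Dart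
  rw [Nat.card_eq_fintype_card, ← Finset.card_univ,
    Finset.card_eq_sum_card_fiberwise (f := fun d : G.Dart => d.fst) (t := Finset.univ)
      (fun _ _ => by simp)]
  have : ∀ v, ({d : G.Dart | d.fst = v} : Finset _).card = 3 := fun v => by
    rw [← hc v, ← card_darts_at, Nat.card_eq_fintype_card, Fintype.card_subtype]
  simp [this, mul_comm]

variable {M}

/-- Count darts by vertices, edges and faces: 3|V| = 2|E| = 6|Φ| − p for p pentagons, and Euler's
formula gives p = 12. -/
theorem IsFullerene.ncard_pentagons (hM : M.IsFullerene) :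
    {A | M.faceLength A = 5}.ncard = 12 := by
  classical
  have := Fintype.ofFinite M.Face
  have h1 := M.card_dart_eq_sum_faceLength
  have h2 := card_dart_eq_two_mul (G := G)
  have h3 := card_dart_of_cubic hM.cubic
  have h4 := hM.plane.2
  have h5 : ∀ F, M.faceLength F = 6 - if M.faceLength F = 5 then 1 else 0 := fun F => by
    rcases hM.faceLength_eq F with h | h <;> simp [h]
  have h6 : ∑ F : M.Face, M.faceLength F + ∑ F : M.Face, (if M.faceLength F = 5 then 1 else 0)
      = 6 * Nat.card M.Face := by
    rw [← Finset.sum_add_distrib, Finset.sum_congr rfl (g := fun _ => 6)]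
    · simp [mul_comm]
    · intro F _
      rcases hM.faceLength_eq F with h | h <;> simp [h]
  rw [← Finset.card_filter] at h6
  rw [Set.ncard_eq_toFinset_card']
  simp only [Set.toFinset_ofPred]
  omega

theorem IsFullerene.iterate_symm_ne (hM : M.IsFullerene) (x : G.Dart) :
    M.facePerm (M.facePerm (M.facePerm (M.facePerm x.symm))) ≠ x := by
  intro h
  rcases hM.faceLength_eq (M.faceOf x.symm) with h5 | h6
  · have := M.iterate_five h5
    rw [h, facePerm_apply] at this
    exact M.rot_ne hM.cubic _ this
  · have := M.iterate_six h6
    rw [h, facePerm_apply, facePerm_apply] at this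
    have h' := congrArg (fun d => d.fst) this
    simp only [fst_rot, SimpleGraph.Dart.symm_toProd, Prod.fst_swap] at h'
    have := (M.rot x.symm).adj
    rw [h', fst_rot] at this
    exact this.ne rfl

theorem IsFullerene.not_triangle_of_left_left (hM : M.IsFullerene) (d : G.Dart) :
    (M.facePerm (M.facePerm d)).snd ≠ d.fst := by
  intro h
  have h3 : (M.facePerm (M.facePerm (M.facePerm d))).fst = d.fst := by rw [fst_facePerm, h]
  rcases M.eq_or_eq_rot_of_fst_eq hM.cubic h3 with h | h | h
  · have h3 : M.facePerm^[3] d = d := h.symm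
    refine M.iterate_ne_of_lt (i := 3) (by omega) ?_ h3
    rcases hM.faceLength_eq (M.faceOf d) with h | h <;> omega
  · refine hM.iterate_symm_ne (M.facePerm (M.facePerm (M.facePerm d))) ?_
    rw [facePerm_symm, ← h]
  · have h' : d = (M.facePerm (M.facePerm d)).symm := h.trans (M.rot_rot_rot hM.cubic _)
    have h2 : d.snd = (M.facePerm (M.facePerm d)).fst := congrArg (fun d => d.snd) h'
    rw [fst_facePerm, ← M.fst_facePerm d] at h2
    exact (M.facePerm d).adj.ne h2

theorem IsFullerene.turn (hM : M.IsFullerene) {a b c : V} (hab : G.Adj a b) (hbc : G.Adj b c)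
    (hac : a ≠ c) : M.facePerm ⟨(a, b), hab⟩ = ⟨(b, c), hbc⟩ ∨
      M.facePerm ⟨(c, b), hbc.symm⟩ = ⟨(b, a), hab.symm⟩ := by
  rcases M.eq_or_eq_rot_of_fst_eq hM.cubic
    (show (⟨(b, a), hab.symm⟩ : G.Dart).fst = (⟨(b, c), hbc⟩ : G.Dart).fst from rfl)
    with h | h | h
  · exact absurd (congrArg (fun d => d.snd) h).symm hac
  · exact .inl h.symm
  · right
    change M.rot ⟨(b, c), hbc⟩ = _
    rw [h, M.rot_rot_rot hM.cubic]

/-- At each corner of a triangle one of the two traversals follows a facial walk. Two of the three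
corners agree, giving two consecutive facial steps inside the triangle. -/
theorem IsFullerene.not_adj_of_adj_of_adj (hM : M.IsFullerene) {a b c : V} (hab : G.Adj a b)
    (hbc : G.Adj b c) : ¬ G.Adj c a := by
  intro hca
  have key : ∀ {a b c : V} (hab : G.Adj a b) (hbc : G.Adj b c) (hca : G.Adj c a),
      M.facePerm ⟨(a, b), hab⟩ = ⟨(b, c), hbc⟩ → M.facePerm ⟨(b, c), hbc⟩ = ⟨(c, a), hca⟩ →
      False := fun {a b c} hab hbc hca h1 h2 =>
    hM.not_triangle_of_left_left ⟨(a, b), hab⟩ (by rw [h1, h2])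
  rcases hM.turn hab hbc hca.ne.symm with h1 | h1 <;>
  rcases hM.turn hbc hca hab.ne.symm with h2 | h2 <;>
  rcases hM.turn hca hab hbc.ne.symm with h3 | h3
  · exact key _ _ _ h1 h2
  · exact key _ _ _ h1 h2
  · exact key _ _ _ h3 h1
  · exact key _ _ _ h3 h2
  · exact key _ _ _ h2 h3
  · exact key _ _ _ h1 h3
  · exact key _ _ _ h2 h1
  · exact key _ _ _ h2 h1

theorem IsFullerene.edist_eq_two (hM : M.IsFullerene) {a b c : V} (hab : G.Adj b a)
    (hbc : G.Adj b c) (hac : a ≠ c) : G.edist a c = 2 := by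
  refine le_antisymm ?_ ?_
  · exact SimpleGraph.edist_le (.cons hab.symm (.cons hbc .nil))
  · have h0 : G.edist a c ≠ 0 := by rwa [Ne, SimpleGraph.edist_eq_zero_iff]
    have h1 : G.edist a c ≠ 1 := by
      rw [Ne, SimpleGraph.edist_eq_one_iff_adj]
      exact fun h => hM.not_adj_of_adj_of_adj hab.symm hbc h.symm
    generalize G.edist a c = n at *
    induction n using ENat.recTopCoe with
    | top => simp
    | coe n =>
      norm_cast at *
      omega

end Fullerene

/-! ### Colorings that are injective on neighborhoods -/

section Coloring

theorem snd_ne_of_ne {d e : G.Dart} (h : d.fst = e.fst) (hne : d ≠ e) : d.snd ≠ e.snd :=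
  fun h' => hne (SimpleGraph.Dart.ext _ _ (Prod.ext h h'))

theorem _root_.Fin.eq_of_ne_three {a b c x : Fin 3} (hab : a ≠ b) (hac : a ≠ c) (hbc : b ≠ c)
    (ha : x ≠ a) (hb : x ≠ b) : x = c := by
  omega

/-- The coloring `c` is injective on the neighborhood of each vertex. -/
def NbrInjective {α : Type*} (G : SimpleGraph V) (c : V → α) : Prop :=
  ∀ d e : G.Dart, d.fst = e.fst → d ≠ e → c d.snd ≠ c e.snd

variable {M} {α : Type*}

theorem IsFullerene.exactSquareColorable_iff [Finite V] (hM : M.IsFullerene) (n : ℕ) :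
    G.ExactSquareColorable n ↔ ∃ c : V → Fin n, NbrInjective G c := by
  constructor
  · rintro ⟨c⟩
    refine ⟨c, fun d e h hne => c.valid ?_⟩
    have h1 := snd_ne_of_ne h hne
    exact ⟨h1, hM.edist_eq_two d.adj (h ▸ e.adj) h1⟩
  · rintro ⟨c, hc⟩
    refine ⟨SimpleGraph.Coloring.mk c ?_⟩
    rintro u w ⟨hne, h⟩
    obtain ⟨p, hp⟩ := SimpleGraph.exists_walk_of_edist_ne_top (G := G) (u := u) (v := w)
      (by rw [h]; simp)
    rw [h] at hp
    have hp2 : p.length = 2 := by exact_mod_cast hp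
    cases p with
    | nil => simp at hp2
    | @cons _ v _ h1 p =>
      cases p with
      | nil => simp at hp2
      | @cons _ x _ h2 p =>
        cases p with
        | nil =>
          exact hc ⟨(v, u), h1.symm⟩ ⟨(v, w), h2⟩ rfl
            (fun h => hne (congrArg (fun d => d.snd) h))
        | cons _ p => simp at hp2

section

variable [Finite V] (hc : ∀ v, (G.neighborSet v).ncard = 3) {c : V → α} (hn : NbrInjective G c)
include hc hn

theorem NbrInjective.rot_ne (d : G.Dart) : c (M.rot d).snd ≠ c d.snd :=
  hn _ _ (M.fst_rot _) (M.rot_ne hc d)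

theorem NbrInjective.facePerm_ne (d : G.Dart) :
    c (M.facePerm (M.facePerm d)).fst ≠ c d.fst := by
  rw [fst_facePerm]
  exact hn.rot_ne hc d.symm

end

/-! ### Bases of pentagons, and the drum forced by a coloring -/

/-- The dart `d` is the side opposite to the apex of a pentagon colored `A, B, B, C, A` from the
tail of `d`. -/
def IsBase (M : RotationSystem G) (c : V → α) (d : G.Dart) : Prop :=
  M.faceLength (M.faceOf d) = 5 ∧
    c (M.facePerm d).fst = c (M.facePerm (M.facePerm d)).fst ∧
    c (M.facePerm (M.facePerm (M.facePerm (M.facePerm d)))).fst = c d.fst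

variable [Finite V] {c : V → Fin 3}

theorem IsFullerene.exists_isBase (hM : M.IsFullerene) (hn : NbrInjective G c) (d : G.Dart)
    (h : M.faceLength (M.faceOf d) = 5) : ∃ e, M.faceOf e = M.faceOf d ∧ M.IsBase c e := by
  have h5 := M.iterate_five h
  have n0 := hn.facePerm_ne (M := M) hM.cubic d
  have n1 := hn.facePerm_ne (M := M) hM.cubic (M.facePerm d)
  have n2 := hn.facePerm_ne (M := M) hM.cubic (M.facePerm (M.facePerm d))
  have n3 := hn.facePerm_ne (M := M) hM.cubic (M.facePerm (M.facePerm (M.facePerm d)))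
  have n4 := hn.facePerm_ne (M := M) hM.cubic
    (M.facePerm (M.facePerm (M.facePerm (M.facePerm d))))
  -- The five alternatives say that the base is the side 0, 1, 2, 3 or 4 steps after `d`.
  have key : ∀ a b c d e : Fin 3, c ≠ a → d ≠ b → e ≠ c → a ≠ d → b ≠ e →
      (b = c ∧ e = a) ∨ (c = d ∧ a = b) ∨ (d = e ∧ b = c) ∨ (e = a ∧ c = d) ∨ (a = b ∧ d = e) := by
    decide
  rw [h5] at n3 n4
  rcases key _ _ _ _ _ n0 n1 n2 n3 n4 with h' | h' | h' | h' | h'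
  · exact ⟨d, rfl, h, h'⟩
  · exact ⟨M.facePerm^[1] d, M.faceOf_iterate _ _, by rwa [faceOf_iterate], by
      simpa [h5] using h'⟩
  · exact ⟨M.facePerm^[2] d, M.faceOf_iterate _ _, by rwa [faceOf_iterate], by
      simpa [h5] using h'⟩
  · exact ⟨M.facePerm^[3] d, M.faceOf_iterate _ _, by rwa [faceOf_iterate], by
      simpa [h5] using h'⟩
  · exact ⟨M.facePerm^[4] d, M.faceOf_iterate _ _, by rwa [faceOf_iterate], by
      simpa [h5] using h'⟩

theorem IsFullerene.isBase_unique (hM : M.IsFullerene) (hn : NbrInjective G c) {d e : G.Dart}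
    (hd : M.IsBase c d) (he : M.IsBase c e) (h : M.faceOf d = M.faceOf e) : d = e := by
  have h5 := M.iterate_five hd.1
  have n0 := hn.facePerm_ne (M := M) hM.cubic d
  have n1 := hn.facePerm_ne (M := M) hM.cubic (M.facePerm d)
  have n2 := hn.facePerm_ne (M := M) hM.cubic (M.facePerm (M.facePerm d))
  have n3 := hn.facePerm_ne (M := M) hM.cubic (M.facePerm (M.facePerm (M.facePerm d)))
  have n4 := hn.facePerm_ne (M := M) hM.cubic
    (M.facePerm (M.facePerm (M.facePerm (M.facePerm d))))
  rw [h5] at n3 n4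
  obtain ⟨hd, d1, d2⟩ := hd
  obtain ⟨-, e1, e2⟩ := he
  rcases M.eq_of_faceOf_eq_of_five hd h with h' | h' | h' | h' | h'
  · exact h'.symm
  all_goals
    exfalso
    subst h'
    simp only [h5] at e1 e2
    simp_all

/-- With colors A, B, B, C, A from the tail of `d`, the third neighbors of the tail and of the apex
both have color C. Following colors through the face beyond the side from the apex to the vertex
before the tail determines the face across `M.rot d`: it reads C, A, A, B, C, and cannot be a
hexagon. -/
theorem IsFullerene.isBase_next (hM : M.IsFullerene) (hn : NbrInjective G c) {d : G.Dart}
    (hd : M.IsBase c d) : M.IsBase c (M.rot d).symm := by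
  have hcub := hM.cubic
  have h5 := M.iterate_five hd.1
  obtain ⟨-, hB, hA⟩ := hd
  have n0 := hn.facePerm_ne (M := M) hcub d
  have n1 := hn.facePerm_ne (M := M) hcub (M.facePerm d)
  have n3 := hn.facePerm_ne (M := M) hcub (M.facePerm (M.facePerm (M.facePerm d)))
  rw [h5] at n3
  set p₂ := M.facePerm (M.facePerm d) with hp₂
  set p₃ := M.facePerm p₂ with hp₃
  set p₄ := M.facePerm p₃ with hp₄
  have e₄ : M.rot (M.rot p₄) = p₃.symm := by
    rw [hp₄, facePerm_apply, M.rot_rot_rot hcub]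
  have e₃ : M.rot (M.rot p₃) = p₂.symm := by
    rw [hp₃, facePerm_apply, M.rot_rot_rot hcub]
  have e₀ : M.rot (M.rot d) = p₄.symm := by
    rw [← h5, facePerm_apply, M.rot_rot_rot hcub]
  have s₂ : p₂.snd = p₃.fst := (M.fst_facePerm _).symm
  have s₃ : p₃.snd = p₄.fst := (M.fst_facePerm _).symm
  have s₄ : p₄.snd = d.fst := by rw [← M.fst_facePerm, h5]
  have s₀ : c d.snd = c p₂.fst := by rw [← hB, M.fst_facePerm]
  -- the third neighbors of the apex and of the tail of `d`
  set z := M.rot p₄ with hz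
  have q₁ := hn.rot_ne (M := M) hcub p₃
  have q₂ := hn.rot_ne (M := M) hcub (M.rot p₃)
  have w₁ := hn.rot_ne (M := M) hcub d
  have w₂ := hn.rot_ne (M := M) hcub (M.rot d)
  rw [e₃] at q₂
  rw [e₀] at w₂
  simp only [SimpleGraph.Dart.symm_toProd, Prod.snd_swap] at q₂ w₂
  rw [s₃, hA] at q₁
  rw [s₀] at w₁
  rw [hA] at w₂
  have hq : c (M.rot p₃).snd = c p₃.fst :=
    Fin.eq_of_ne_three n0.symm n3 (n1.trans_eq hB).symm q₁ q₂.symm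
  have hw : c (M.rot d).snd = c p₃.fst :=
    Fin.eq_of_ne_three n0.symm n3 (n1.trans_eq hB).symm w₂.symm w₁
  -- the face on the other side of `p₄` and the apex
  have g₁ : M.facePerm z.symm = p₃.symm := by rw [facePerm_symm, hz, e₄]
  have g₂ : M.facePerm p₃.symm = M.rot p₃ := M.facePerm_symm _
  -- This vertex is two steps from a vertex colored A and from one colored C: the apex if the face
  -- is a pentagon, the third neighbor of the apex if it is a hexagon.
  have hr : c (M.rot (M.rot z.symm)).snd = c p₂.fst := by
    rcases hM.faceLength_eq (M.faceOf z.symm) with h | h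
    · have h' := M.iterate_five h
      rw [g₁, g₂] at h'
      have r₁ := hn.facePerm_ne (M := M) hcub (M.rot p₃)
      have r₂ := hn.facePerm_ne (M := M) hcub (M.facePerm (M.facePerm (M.rot p₃)))
      have hsymm : M.rot (M.rot z.symm) = (M.facePerm (M.facePerm (M.rot p₃))).symm := by
        rw [← h', facePerm_apply, M.rot_rot_rot hcub]
      rw [h', g₁] at r₂
      rw [hsymm]
      rw [fst_rot] at r₁
      simp only [SimpleGraph.Dart.symm_toProd, Prod.snd_swap, Prod.fst_swap] at r₂ ⊢
      rw [s₃, hA] at r₂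
      exact Fin.eq_of_ne_three n3 n0.symm (n1.trans_eq hB) r₂.symm r₁
    · have h' := M.iterate_six h
      rw [g₁, g₂] at h'
      have r₁ := hn.facePerm_ne (M := M) hcub (M.facePerm (M.rot p₃))
      have r₂ := hn.facePerm_ne (M := M) hcub (M.facePerm (M.facePerm (M.facePerm (M.rot p₃))))
      have hsymm : M.rot (M.rot z.symm)
          = (M.facePerm (M.facePerm (M.facePerm (M.rot p₃)))).symm := by
        rw [← h', facePerm_apply, M.rot_rot_rot hcub]
      rw [h', g₁] at r₂
      rw [hsymm]
      rw [fst_facePerm M (M.rot p₃), hq] at r₁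
      simp only [SimpleGraph.Dart.symm_toProd, Prod.snd_swap, Prod.fst_swap] at r₂ ⊢
      rw [s₃, hA] at r₂
      exact Fin.eq_of_ne_three n3 n0.symm (n1.trans_eq hB) r₂.symm r₁
  have t₁ := hn.rot_ne (M := M) hcub z.symm
  have t₂ := hn.rot_ne (M := M) hcub (M.rot z.symm)
  rw [hr] at t₂
  simp only [SimpleGraph.Dart.symm_toProd, Prod.snd_swap] at t₁
  rw [hz, fst_rot, hA, ← hz] at t₁
  have ht : c (M.rot z.symm).snd = c p₃.fst :=
    Fin.eq_of_ne_three n0.symm n3 (n1.trans_eq hB).symm t₁ t₂.symm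
  -- the face on the other side of `M.rot d`
  have f₁ : M.facePerm (M.rot d).symm = p₄.symm := by rw [facePerm_symm, e₀]
  have f₂ : M.facePerm p₄.symm = z := by rw [facePerm_symm, hz]
  have f₄ : (M.facePerm (M.facePerm z)).fst = (M.rot z.symm).snd := M.fst_facePerm _
  refine ⟨(hM.faceLength_eq _).resolve_right fun h => ?_, ?_, ?_⟩
  -- In a hexagon the fifth vertex and the first, both colored C, would have a common neighbor.
  · have h' := M.iterate_six h
    rw [f₁, f₂] at h'
    have u := hn.facePerm_ne (M := M) hcub (M.facePerm (M.facePerm z))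
    rw [h', f₄, ht] at u
    simp only [SimpleGraph.Dart.symm_toProd, Prod.fst_swap] at u
    exact u hw
  · rw [f₁, f₂, hz, fst_rot]
    simp only [SimpleGraph.Dart.symm_toProd, Prod.fst_swap]
    rw [s₄, hA]
  · rw [f₁, f₂, f₄, ht]
    exact hw.symm

theorem IsFullerene.isBase_symm_of_faceOf_eq (hM : M.IsFullerene) (hn : NbrInjective G c)
    {d e : G.Dart} (hd : M.IsBase c d) (h : M.faceOf d.symm = M.faceOf e) :
    M.IsBase c e.symm := by
  obtain ⟨i, -, rfl⟩ := M.faceOf_eq_iff_exists.1 h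
  clear h
  induction i with
  | zero => simpa using hd
  | succ n ih =>
    rw [Function.iterate_succ_apply']
    have := hM.isBase_next hn ih
    rwa [← facePerm_symm, SimpleGraph.Dart.symm_symm] at this

/-- The ends of a base have different colors, so on a pentagon bounded by bases all five vertices
would have distinct colors. -/
theorem IsFullerene.faceLength_symm_of_isBase (hM : M.IsFullerene) (hn : NbrInjective G c)
    {d : G.Dart} (hd : M.IsBase c d) : M.faceLength (M.faceOf d.symm) = 6 := by
  refine (hM.faceLength_eq _).resolve_left fun h => ?_
  have key : ∀ e, M.faceOf d.symm = M.faceOf e → c e.fst ≠ c (M.facePerm e).fst := fun e he => by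
    obtain ⟨-, h1, h2⟩ := hM.isBase_symm_of_faceOf_eq hn hd he
    have := hn.facePerm_ne (M := M) hM.cubic e.symm
    rw [← h1, fst_facePerm] at this
    rw [fst_facePerm]
    exact this
  have n0 := hn.facePerm_ne (M := M) hM.cubic d.symm
  have n1 := hn.facePerm_ne (M := M) hM.cubic (M.facePerm d.symm)
  have n2 := hn.facePerm_ne (M := M) hM.cubic (M.facePerm (M.facePerm d.symm))
  have n3 := hn.facePerm_ne (M := M) hM.cubic (M.facePerm (M.facePerm (M.facePerm d.symm)))
  have n4 := hn.facePerm_ne (M := M) hM.cubic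
    (M.facePerm (M.facePerm (M.facePerm (M.facePerm d.symm))))
  have k0 := key _ (M.faceOf_iterate 0 d.symm).symm
  have k1 := key _ (M.faceOf_iterate 1 d.symm).symm
  have k2 := key _ (M.faceOf_iterate 2 d.symm).symm
  have k3 := key _ (M.faceOf_iterate 3 d.symm).symm
  have k4 := key _ (M.faceOf_iterate 4 d.symm).symm
  simp only [Function.iterate_succ, Function.iterate_zero, Function.comp_apply, id_eq,
    M.iterate_five h] at k0 k1 k2 k3 k4
  rw [M.iterate_five h] at n3 n4
  omega

theorem IsFullerene.fiveFaceNeighbors_of_isBase (hM : M.IsFullerene) (hn : NbrInjective G c)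
    {d : G.Dart} (hd : M.IsBase c d) : M.fiveFaceNeighbors (M.faceOf d.symm)
      = (fun e : G.Dart => M.faceOf e.symm) '' {e | M.faceOf e = M.faceOf d.symm} := by
  ext A
  constructor
  · rintro ⟨⟨-, e, he, rfl⟩, -⟩
    exact ⟨e, he, rfl⟩
  · rintro ⟨e, he, rfl⟩
    have h5 := (hM.isBase_symm_of_faceOf_eq hn hd (Eq.symm he)).1
    refine ⟨⟨fun h => ?_, e, he, rfl⟩, h5⟩
    have := hM.faceLength_symm_of_isBase hn hd
    rw [h, h5] at this
    omega

theorem IsFullerene.ncard_fiveFaceNeighbors_of_isBase (hM : M.IsFullerene)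
    (hn : NbrInjective G c) {d : G.Dart} (hd : M.IsBase c d) :
    (M.fiveFaceNeighbors (M.faceOf d.symm)).ncard = 6 := by
  rw [hM.fiveFaceNeighbors_of_isBase hn hd, Set.InjOn.ncard_image,
    ← hM.faceLength_symm_of_isBase hn hd]
  · rfl
  · intro e he e' he' h
    exact SimpleGraph.Dart.symm_involutive.injective
      (hM.isBase_unique hn (hM.isBase_symm_of_faceOf_eq hn hd (Eq.symm he))
        (hM.isBase_symm_of_faceOf_eq hn hd (Eq.symm he')) h)

theorem faceGraph_edist_ne_top (hG : G.Connected) (A B : M.Face) :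
    M.faceGraph.edist A B ≠ ⊤ := by
  obtain ⟨d, rfl⟩ := M.faceOf_surjective A
  rw [SimpleGraph.edist_ne_top_iff_reachable]
  refine M.face_induction hG d (p := fun B => M.faceGraph.Reachable (M.faceOf d) B) ?_ ?_ B
  · exact SimpleGraph.Reachable.refl _
  · intro e he
    by_cases h : M.faceOf e = M.faceOf e.symm
    · rwa [← h]
    · exact he.trans (SimpleGraph.Adj.reachable ⟨h, e, rfl, rfl⟩)

theorem IsFullerene.exists_isDrum_of_nbrInjective (hM : M.IsFullerene) (hn : NbrInjective G c) :
    ∃ k, 0 < k ∧ M.IsDrum k := by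
  have h12 := hM.ncard_pentagons
  obtain ⟨A, hA⟩ : {A | M.faceLength A = 5}.Nonempty := by
    rw [← Set.ncard_pos (Set.toFinite _)]; omega
  obtain ⟨d₀, rfl⟩ := M.faceOf_surjective A
  obtain ⟨d, -, hd⟩ := hM.exists_isBase hn d₀ hA
  have hF := hM.ncard_fiveFaceNeighbors_of_isBase hn hd
  -- Six of the twelve pentagons remain; the base of any of them leads to the second hexagon.
  obtain ⟨B, hB, hBF⟩ : ∃ B ∈ {A | M.faceLength A = 5},
      B ∉ M.fiveFaceNeighbors (M.faceOf d.symm) :=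
    Set.exists_mem_notMem_of_ncard_lt_ncard (by omega) (Set.toFinite _)
  obtain ⟨e₀, rfl⟩ := M.faceOf_surjective B
  obtain ⟨e, hee, he⟩ := hM.exists_isBase hn e₀ hB
  rw [← hee] at hBF
  have hne : M.faceOf d.symm ≠ M.faceOf e.symm := fun h => hBF <| by
    rw [hM.fiveFaceNeighbors_of_isBase hn hd]
    exact ⟨e.symm, h.symm, by simp⟩
  have hF6 := hM.faceLength_symm_of_isBase hn hd
  have hE6 := hM.faceLength_symm_of_isBase hn he
  have hdisj : Disjoint (M.fiveFaceNeighbors (M.faceOf d.symm))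
      (M.fiveFaceNeighbors (M.faceOf e.symm)) := by
    rw [hM.fiveFaceNeighbors_of_isBase hn hd, hM.fiveFaceNeighbors_of_isBase hn he,
      Set.disjoint_left]
    rintro _ ⟨x, hx, rfl⟩ ⟨y, hy, hxy⟩
    have := hM.isBase_unique hn (hM.isBase_symm_of_faceOf_eq hn he (Eq.symm hy))
      (hM.isBase_symm_of_faceOf_eq hn hd (Eq.symm hx)) hxy
    rw [SimpleGraph.Dart.symm_involutive.injective this] at hy
    exact hne (Eq.trans (Eq.symm hx) hy)
  have htop := faceGraph_edist_ne_top (M := M) hM.plane.1 (M.faceOf d.symm) (M.faceOf e.symm)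
  have h0 : M.faceGraph.edist (M.faceOf d.symm) (M.faceOf e.symm) ≠ 0 := by
    rwa [Ne, SimpleGraph.edist_eq_zero_iff]
  -- Every neighbor of the first hexagon is a pentagon.
  have h1 : M.faceGraph.edist (M.faceOf d.symm) (M.faceOf e.symm) ≠ 1 := by
    rw [Ne, SimpleGraph.edist_eq_one_iff_adj]
    rintro ⟨-, x, hx, hx'⟩
    have := (hM.isBase_symm_of_faceOf_eq hn hd (Eq.symm hx)).1
    rw [hx', hE6] at this
    omega
  obtain ⟨n, hdist⟩ := ENat.ne_top_iff_exists.1 htop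
  rw [← hdist] at h0 h1
  norm_cast at h0 h1
  refine ⟨n - 1, by omega, hM, _, _, hF6, hE6, hF,
    hM.ncard_fiveFaceNeighbors_of_isBase hn he, hdisj, ?_⟩
  rw [← hdist, Nat.sub_add_cancel (by omega)]

end Coloring

/-! ### Caps -/

/-- The set `S` of darts consists of the facial walks of hexagons that are surrounded by pentagons,
in such a way that each pentagon shares exactly one edge with one of these hexagons. -/
structure IsCapSet (S : G.Dart → Prop) : Prop where
  facePerm_iff : ∀ d, S (M.facePerm d) ↔ S d
  six : ∀ d, S d → M.faceLength (M.faceOf d) = 6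
  five : ∀ d, S d → M.faceLength (M.faceOf d.symm) = 5
  unique : ∀ d e : G.Dart, S d.symm → S e.symm → M.faceOf d = M.faceOf e → d = e
  exists_base : ∀ d, M.faceLength (M.faceOf d) = 5 → ∃ e : G.Dart, M.faceOf e = M.faceOf d ∧
    S e.symm

/-- Six darts must reach six distinct neighbors, so crossing the sides is a bijection onto the
pentagons. -/
theorem cap_of_ncard [Finite V] {F : M.Face} (h6 : M.faceLength F = 6)
    (hF : (M.fiveFaceNeighbors F).ncard = 6) :
    (∀ d, M.faceOf d = F → M.faceOf d.symm ∈ M.fiveFaceNeighbors F) ∧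
      Set.InjOn (fun d : G.Dart => M.faceOf d.symm) {d | M.faceOf d = F} := by
  have hT : {d : G.Dart | M.faceOf d = F}.ncard = 6 := h6
  have hsub : M.fiveFaceNeighbors F
      ⊆ (fun d : G.Dart => M.faceOf d.symm) '' {d | M.faceOf d = F} := by
    rintro A ⟨⟨-, e, he, rfl⟩, -⟩
    exact ⟨e, he, rfl⟩
  have hle := Set.ncard_image_le (f := fun d : G.Dart => M.faceOf d.symm)
    (Set.toFinite {d : G.Dart | M.faceOf d = F})
  have heq := Set.eq_of_subset_of_ncard_le hsub (by omega) (Set.toFinite _)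
  refine ⟨fun d hd => heq ▸ ⟨d, hd, rfl⟩, Set.injOn_of_ncard_image_eq ?_ (Set.toFinite _)⟩
  rw [← heq, hF, hT]

/-- The two disjoint rings of six exhaust the twelve pentagons, so each pentagon touches exactly one
cap, in exactly one edge. -/
theorem IsDrum.exists_isCapSet [Finite V] {M : RotationSystem G} {k : ℕ} (h : M.IsDrum k) :
    ∃ F F' : M.Face, (∃ d, M.faceOf d = F) ∧
      M.IsCapSet fun d => M.faceOf d = F ∨ M.faceOf d = F' := by
  obtain ⟨hM, F, F', h6, h6', hF, hF', hdisj, hdist⟩ := h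
  obtain ⟨hn, hi⟩ := M.cap_of_ncard h6 hF
  obtain ⟨hn', hi'⟩ := M.cap_of_ncard h6' hF'
  have hun : M.fiveFaceNeighbors F ∪ M.fiveFaceNeighbors F' = {A | M.faceLength A = 5} := by
    refine Set.eq_of_subset_of_ncard_le ?_ ?_ (Set.toFinite _)
    · rintro A (hA | hA)
      exacts [hA.2, hA.2]
    · rw [hM.ncard_pentagons, Set.ncard_union_eq hdisj (Set.toFinite _) (Set.toFinite _)]
      omega
  have hne : F ≠ F' := by
    rintro rfl
    rw [SimpleGraph.edist_self] at hdist
    norm_cast at hdist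
  refine ⟨F, F', M.faceOf_surjective F, ⟨?_, ?_, ?_, ?_, ?_⟩⟩
  · intro d
    rw [faceOf_facePerm]
  · rintro d (rfl | rfl)
    exacts [h6, h6']
  · rintro d (hd | hd)
    exacts [(hn d hd).2, (hn' d hd).2]
  · have hcross : ∀ d e : G.Dart, M.faceOf d.symm = F → M.faceOf e.symm = F' →
        M.faceOf d ≠ M.faceOf e := fun d e hd he h => by
      have h1 := hn _ hd
      have h2 := hn' _ he
      rw [SimpleGraph.Dart.symm_symm] at h1 h2
      rw [h] at h1
      exact Set.disjoint_left.1 hdisj h1 h2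
    rintro d e (hd | hd) (he | he) hde
    · exact SimpleGraph.Dart.symm_involutive.injective (hi hd he (by simpa using hde))
    · exact absurd hde (hcross _ _ hd he)
    · exact absurd hde.symm (hcross _ _ he hd)
    · exact SimpleGraph.Dart.symm_involutive.injective (hi' hd he (by simpa using hde))
  · intro d hd
    have : M.faceOf d ∈ M.fiveFaceNeighbors F ∪ M.fiveFaceNeighbors F' := by rwa [hun]
    rcases this with ⟨⟨-, e, he, he'⟩, -⟩ | ⟨⟨-, e, he, he'⟩, -⟩
    · exact ⟨e.symm, he', by simp [he]⟩
    · exact ⟨e.symm, he', by simp [he]⟩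

/-- The dart `d` starts at a vertex of one of the hexagons in `S`. -/
def AtCap (S : G.Dart → Prop) (d : G.Dart) : Prop :=
  S d ∨ S (M.rot d) ∨ S (M.rot (M.rot d))

variable {M} in
theorem atCap_rot [Finite V] (hcub : ∀ v, (G.neighborSet v).ncard = 3) {S : G.Dart → Prop}
    (d : G.Dart) : M.AtCap S (M.rot d) ↔ M.AtCap S d := by
  unfold AtCap
  rw [M.rot_rot_rot hcub]
  tauto

namespace IsCapSet

variable {M} {S : G.Dart → Prop} (hS : M.IsCapSet S)

include hS

theorem rot_iff (d : G.Dart) : S (M.rot d) ↔ S d.symm := by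
  rw [← facePerm_symm, hS.facePerm_iff]

theorem not_symm {d : G.Dart} (h : S d) : ¬ S d.symm := fun h' => by
  have h1 := hS.five d h
  have h2 := hS.six _ h'
  omega

theorem not_of_faceOf_eq {d e : G.Dart} (h : S e.symm) (hde : M.faceOf d = M.faceOf e) :
    ¬ S d := fun h' => by
  have h1 := hS.five _ h
  have h2 := hS.six _ h'
  rw [SimpleGraph.Dart.symm_symm, ← hde] at h1
  omega

theorem iterate_iff (d : G.Dart) (i : ℕ) : S (M.facePerm^[i] d) ↔ S d := by
  induction i with
  | zero => rfl
  | succ n ih => rw [Function.iterate_succ_apply', hS.facePerm_iff, ih]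

theorem hexagon_iterate {d : G.Dart} (h6 : M.faceLength (M.faceOf d) = 6) (hd : ¬ S d) (i : ℕ) :
    ¬ S (M.facePerm^[i] d) ∧ ¬ S (M.facePerm^[i] d).symm := by
  refine ⟨by rwa [hS.iterate_iff], fun h => ?_⟩
  have := hS.five _ h
  rw [SimpleGraph.Dart.symm_symm, faceOf_iterate] at this
  omega

theorem base_five {b : G.Dart} (hb : S b.symm) : M.faceLength (M.faceOf b) = 5 := by
  simpa using hS.five _ hb

section Finite

variable [Finite V]

theorem atCap_facePerm (hcub : ∀ v, (G.neighborSet v).ncard = 3) (d : G.Dart) :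
    M.AtCap S (M.facePerm d) ↔ S d ∨ S (M.facePerm d).symm ∨ S d.symm := by
  have h1 : M.rot (M.rot (M.facePerm d)) = d.symm := by
    rw [facePerm_apply, M.rot_rot_rot hcub]
  rw [AtCap, h1, hS.facePerm_iff, hS.rot_iff]

theorem base_iterate {b : G.Dart} (hb : S b.symm) {i : ℕ} (h0 : 0 < i) (h5 : i < 5) :
    ¬ S (M.facePerm^[i] b) ∧ ¬ S (M.facePerm^[i] b).symm := by
  refine ⟨hS.not_of_faceOf_eq hb (M.faceOf_iterate _ _), fun h => ?_⟩
  refine M.iterate_ne_of_lt h0 ?_ (hS.unique _ _ h hb (M.faceOf_iterate _ _))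
  rwa [hS.base_five hb]

/-- The sum does not depend on the starting dart, so a pentagon may be read from its cap edge. -/
theorem sum_face_eq_zero (hM : M.IsFullerene) {A : Type*} [AddCommMonoid A] (a : G.Dart → A)
    (h1 : ∀ d, S d → ∑ i ∈ Finset.range 6, a (M.facePerm^[i] d) = 0)
    (h2 : ∀ d, M.faceLength (M.faceOf d) = 6 → ¬ S d →
      ∑ i ∈ Finset.range 6, a (M.facePerm^[i] d) = 0)
    (h3 : ∀ d : G.Dart, S d.symm → ∑ i ∈ Finset.range 5, a (M.facePerm^[i] d) = 0) (d : G.Dart) :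
    ∑ i ∈ Finset.range (M.faceLength (M.faceOf d)), a (M.facePerm^[i] d) = 0 := by
  classical
  have := Fintype.ofFinite G.Dart
  rcases hM.faceLength_eq (M.faceOf d) with h | h
  · obtain ⟨b, hb, hbS⟩ := hS.exists_base d h
    rw [← M.sum_face, ← hb, M.sum_face, hS.base_five hbS, h3 b hbS]
  · rw [h]
    by_cases hd : S d
    exacts [h1 d hd, h2 d h hd]

/-- Signs that change along an edge unless it bounds a hexagon in `S`. -/
theorem exists_sign (hM : M.IsFullerene) : ∃ s : V → ℤ, (∀ v, s v = 1 ∨ s v = -1) ∧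
    (∀ d : G.Dart, S d → s d.snd = s d.fst) ∧
    (∀ d : G.Dart, ¬ S d → ¬ S d.symm → s d.snd = -s d.fst) := by
  classical
  let a : G.Dart → ZMod 2 := fun d => if S d ∨ S d.symm then 0 else 1
  have ha0 : ∀ d, S d → a d = 0 := fun d hd => if_pos (.inl hd)
  have ha0' : ∀ d : G.Dart, S d.symm → a d = 0 := fun d hd => if_pos (.inr hd)
  have ha1 : ∀ d : G.Dart, ¬ S d → ¬ S d.symm → a d = 1 := fun d hd hd' =>
    if_neg (not_or.2 ⟨hd, hd'⟩)
  have hsum := hS.sum_face_eq_zero hM a ?_ ?_ ?_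
  · obtain ⟨g, hg⟩ := M.exists_potential hM.plane a (fun d => by simp [a, or_comm]) hsum
    refine ⟨fun v => if g v = 0 then 1 else -1, fun v => ?_, fun d hd => ?_, fun d hd hd' => ?_⟩
    · beta_reduce
      split_ifs <;> simp
    · have := hg d
      rw [ha0 d hd] at this
      simp [sub_eq_zero.1 this.symm]
    · have := hg d
      rw [ha1 d hd hd'] at this
      have key : ∀ x y : ZMod 2, 1 = x - y →
          (if x = 0 then 1 else -1 : ℤ) = -(if y = 0 then 1 else -1) := by decide
      exact key _ _ this
  · refine fun d hd => Finset.sum_eq_zero fun i _ => ha0 _ ((hS.iterate_iff d i).2 hd)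
  · intro d h6 hd
    rw [Finset.sum_congr rfl (g := fun _ => 1) fun i _ =>
      ha1 _ (hS.hexagon_iterate h6 hd i).1 (hS.hexagon_iterate h6 hd i).2]
    decide
  · intro d hd
    rw [Finset.sum_range_succ', Finset.sum_congr rfl (g := fun _ => 1) fun i hi =>
      ha1 _ (hS.base_iterate hd (i := i + 1) (by omega) (by simp at hi; omega)).1
        (hS.base_iterate hd (i := i + 1) (by omega) (by simp at hi; omega)).2]
    rw [Function.iterate_zero_apply, ha0' _ hd]
    decide

end Finite

end IsCapSet

/-! ### Signs and directions relative to the caps -/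

/-- A function on the edges that increases by `q` at each step of the rotation. -/
theorem exists_edge_labelling [Finite V] (hM : M.IsFullerene) {K : Type*} [Field K]
    (q : G.Dart → K) (hrot : ∀ d, q (M.rot d) = q d) (h3 : ∀ d, q d + q d + q d = 0)
    (hface : ∀ d, ∑ i ∈ Finset.range (M.faceLength (M.faceOf d)), q (M.facePerm^[i] d) = 0) :
    ∃ f : G.Dart → K, (∀ d, f d.symm = f d) ∧ ∀ d, f (M.rot d) = f d + q d := by
  classical
  have hcub := hM.cubic
  have hr : ∀ v, ∃ d : G.Dart, d.fst = v := fun v => by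
    obtain ⟨w, hw⟩ : (G.neighborSet v).Nonempty := by
      rw [← Set.ncard_pos (Set.toFinite _), hcub]; omega
    exact ⟨⟨(v, w), hw⟩, rfl⟩
  choose r hr using hr
  -- Solve the rotation condition vertex by vertex from an arbitrary starting dart; `h3` closes the
  -- third step. A function `g` of the tail then remains free to make the result symmetric.
  let f₀ : G.Dart → K := fun d => if d = r d.fst then 0 else
    if d = M.rot (r d.fst) then q d else q d + q d
  have hf₀ : ∀ d, f₀ (M.rot d) = f₀ d + q d := fun d => by
    have n1 := M.rot_ne hcub (r d.fst)
    have n2 := M.rot_rot_ne hcub (r d.fst)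
    have n3 := M.rot_ne hcub (M.rot (r d.fst))
    simp only [f₀, fst_rot, hrot]
    rcases M.eq_or_eq_rot_of_fst_eq hcub (hr d.fst) with h | h | h
    · have e1 : M.rot d = M.rot (r d.fst) := congrArg M.rot h
      rw [if_neg (e1 ▸ n1), if_pos e1, if_pos h, zero_add]
    · have e1 : M.rot d = M.rot (M.rot (r d.fst)) := congrArg M.rot h
      rw [if_neg (e1 ▸ n2), if_neg (e1 ▸ n3), if_neg (by rw [← h] at n1; exact n1), if_pos h]
    · have e1 : M.rot d = r d.fst := (congrArg M.rot h).trans (M.rot_rot_rot hcub _)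
      rw [if_pos e1, if_neg (by rw [← h] at n2; exact n2), if_neg (by rw [← h] at n3; exact n3),
        h3]
  -- The defect of symmetry is `q` at the next dart minus a term that telescopes around the face.
  have hstep : ∀ d : G.Dart, f₀ d - f₀ d.symm = q (M.facePerm d) - (f₀ (M.facePerm d) - f₀ d) :=
    fun d => by
      rw [facePerm_apply, hf₀, hrot]; ring
  obtain ⟨g, hg⟩ := M.exists_potential hM.plane (fun d => f₀ d - f₀ d.symm)
    (fun d => by simp) (fun d => by
      simp_rw [hstep, ← Function.iterate_succ_apply' M.facePerm]
      rw [Finset.sum_sub_distrib, Finset.sum_range_sub (fun i => f₀ (M.facePerm^[i] d)),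
        iterate_faceLength, Function.iterate_zero_apply, sub_self, sub_zero]
      have := hface (M.facePerm d)
      rw [faceOf_facePerm] at this
      exact this)
  refine ⟨fun d => f₀ d + g d.fst, fun d => ?_, fun d => ?_⟩
  · have := hg d
    simp only [SimpleGraph.Dart.symm_toProd, Prod.fst_swap]
    linear_combination -this
  · beta_reduce
    rw [hf₀, fst_rot]; ring

/-- Signs of the vertices and directions of the edges: outside the hexagons in `S` neighboring
vertices have opposite signs and the direction increases by one at each step of the rotation. -/
structure IsDirection (S : G.Dart → Prop) (s : V → ℤ) (f : G.Dart → ZMod 3) : Prop where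
  sign : ∀ v, s v = 1 ∨ s v = -1
  sign_eq : ∀ d : G.Dart, S d → s d.snd = s d.fst
  sign_neg : ∀ d : G.Dart, ¬ S d → ¬ S d.symm → s d.snd = -s d.fst
  symm : ∀ d, f d.symm = f d
  rot_of_atCap : ∀ d, M.AtCap S d → f (M.rot d) = f d
  rot_of_not_atCap : ∀ d, ¬ M.AtCap S d → f (M.rot d) = f d + 1

variable {M} {S : G.Dart → Prop}

theorem IsCapSet.atCap_base (hS : M.IsCapSet S) {b : G.Dart} (hb : S b.symm) : M.AtCap S b :=
  .inr (.inl ((hS.rot_iff b).2 hb))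

variable [Finite V]

/-- The faces at a cap vertex are the cap and two pentagons, which leaves no room for another
hexagon. -/
theorem IsCapSet.not_atCap_of_hexagon (hS : M.IsCapSet S)
    (hcub : ∀ v, (G.neighborSet v).ncard = 3) {d : G.Dart}
    (h6 : M.faceLength (M.faceOf d) = 6) (hd : ¬ S d) : ¬ M.AtCap S d := by
  have h := M.iterate_six h6
  have h5 := hS.hexagon_iterate h6 hd 5
  rw [← h, hS.atCap_facePerm hcub, h]
  exact not_or.2 ⟨h5.1, not_or.2 ⟨(hS.hexagon_iterate h6 hd 0).2, h5.2⟩⟩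

theorem IsCapSet.atCap_facePerm_base (hS : M.IsCapSet S)
    (hcub : ∀ v, (G.neighborSet v).ncard = 3) {b : G.Dart} (hb : S b.symm) :
    M.AtCap S (M.facePerm b) :=
  (hS.atCap_facePerm hcub b).2 (.inr (.inr hb))

theorem IsCapSet.not_atCap_base_iterate (hS : M.IsCapSet S)
    (hcub : ∀ v, (G.neighborSet v).ncard = 3) {b : G.Dart} (hb : S b.symm) {i : ℕ}
    (h1 : 1 < i) (h5 : i < 5) : ¬ M.AtCap S (M.facePerm^[i] b) := by
  obtain ⟨j, rfl⟩ : ∃ j, i = j + 1 := ⟨i - 1, by omega⟩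
  have h := hS.base_iterate hb (i := j) (by omega) (by omega)
  have h' := hS.base_iterate hb (i := j + 1) (by omega) (by omega)
  rw [Function.iterate_succ_apply'] at h' ⊢
  rw [hS.atCap_facePerm hcub]
  exact not_or.2 ⟨h.1, not_or.2 ⟨h'.2, h.2⟩⟩

theorem IsCapSet.exists_isDirection (hS : M.IsCapSet S) (hM : M.IsFullerene) :
    ∃ s f, M.IsDirection S s f := by
  classical
  have hcub := hM.cubic
  obtain ⟨s, h1, h2, h3⟩ := hS.exists_sign hM
  let q : G.Dart → ZMod 3 := fun d => if M.AtCap S d then 0 else 1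
  have q0 : ∀ d, M.AtCap S d → q d = 0 := fun d h => if_pos h
  have q1 : ∀ d, ¬ M.AtCap S d → q d = 1 := fun d h => if_neg h
  obtain ⟨f, hf, hf'⟩ := M.exists_edge_labelling hM q
    (fun d => by simp only [q, M.atCap_rot hcub])
    (fun d => by by_cases h : M.AtCap S d <;> (simp [q0, q1, h]; try decide))
    (hS.sum_face_eq_zero hM q
      (fun d hd => Finset.sum_eq_zero fun i _ => q0 _ (.inl ((hS.iterate_iff d i).2 hd)))
      (fun d h6 hd => by
        rw [Finset.sum_congr rfl (g := fun _ => 1) fun i _ => q1 _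
          (hS.not_atCap_of_hexagon hcub (by rwa [faceOf_iterate]) (hS.hexagon_iterate h6 hd i).1)]
        decide)
      -- Two vertices of a pentagon lie on the cap and contribute 0; the other three contribute 1
      -- each.
      (fun b hb => by
        rw [Finset.sum_range_succ', Finset.sum_range_succ',
          Finset.sum_congr rfl (g := fun _ => 1) fun i hi => q1 _
          (hS.not_atCap_base_iterate hcub hb (i := i + 1 + 1) (by omega)
            (by simp at hi; omega)),
          q0 (M.facePerm^[0] b) (hS.atCap_base hb),
          q0 (M.facePerm^[0 + 1] b) (hS.atCap_facePerm_base hcub hb)]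
        decide))
  exact ⟨s, f, h1, h2, h3, hf, fun d h => by rw [hf', q0 _ h, add_zero],
    fun d h => by rw [hf', q1 _ h]⟩

namespace IsDirection

variable {s : V → ℤ} {f : G.Dart → ZMod 3} (hD : M.IsDirection S s f)
  (hS : M.IsCapSet S) (hcub : ∀ v, (G.neighborSet v).ncard = 3)
include hD

include hcub in
theorem facePerm_of_atCap {d : G.Dart} (h : M.AtCap S (M.facePerm d)) :
    f (M.facePerm d) = f d := by
  rw [facePerm_apply, atCap_rot hcub] at h
  rw [facePerm_apply, hD.rot_of_atCap _ h, hD.symm]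

include hcub in
theorem facePerm_of_not_atCap {d : G.Dart} (h : ¬ M.AtCap S (M.facePerm d)) :
    f (M.facePerm d) = f d + 1 := by
  rw [facePerm_apply, atCap_rot hcub] at h
  rw [facePerm_apply, hD.rot_of_not_atCap _ h, hD.symm]

omit [Finite V] in
theorem sign_facePerm {d : G.Dart} (h : ¬ S d) (h' : ¬ S d.symm) :
    s (M.facePerm d).fst = -s d.fst := by
  rw [fst_facePerm, hD.sign_neg d h h']

omit [Finite V] in
theorem sign_base {b : G.Dart} (hb : S b.symm) : s (M.facePerm b).fst = s b.fst := by
  rw [fst_facePerm]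
  exact (hD.sign_eq _ hb).symm

include hS

include hcub in
theorem iterate_of_cap {d : G.Dart} (hd : S d) (i : ℕ) :
    f (M.facePerm^[i] d) = f d ∧ s (M.facePerm^[i] d).fst = s d.fst := by
  induction i with
  | zero => exact ⟨rfl, rfl⟩
  | succ n ih =>
    have h := (hS.iterate_iff d n).2 hd
    rw [Function.iterate_succ_apply',
      hD.facePerm_of_atCap hcub (.inl ((hS.facePerm_iff _).2 h)), fst_facePerm,
      hD.sign_eq _ h]
    exact ih

include hcub in
theorem iterate_of_hexagon {d : G.Dart} (h6 : M.faceLength (M.faceOf d) = 6) (hd : ¬ S d)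
    (i : ℕ) : f (M.facePerm^[i] d) = f d + i ∧ s (M.facePerm^[i] d).fst = (-1) ^ i * s d.fst := by
  induction i with
  | zero => simp
  | succ n ih =>
    have h := hS.hexagon_iterate h6 hd n
    have h' := hS.not_atCap_of_hexagon hcub (d := M.facePerm^[n + 1] d)
      (by rwa [faceOf_iterate]) (hS.hexagon_iterate h6 hd (n + 1)).1
    rw [Function.iterate_succ_apply'] at h' ⊢
    rw [hD.facePerm_of_not_atCap hcub h', hD.sign_facePerm h.1 h.2, ih.1, ih.2]
    constructor
    · push_cast; ring
    · ring

include hcub in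
theorem base_values {b : G.Dart} (hb : S b.symm) :
    f (M.facePerm^[1] b) = f b ∧ f (M.facePerm^[2] b) = f b + 1 ∧
    f (M.facePerm^[3] b) = f b + 2 ∧ f (M.facePerm^[4] b) = f b ∧
    s (M.facePerm^[1] b).fst = s b.fst ∧ s (M.facePerm^[2] b).fst = -s b.fst ∧
    s (M.facePerm^[3] b).fst = s b.fst ∧ s (M.facePerm^[4] b).fst = -s b.fst := by
  have e1 : f (M.facePerm^[1] b) = f b :=
    hD.facePerm_of_atCap hcub (hS.atCap_facePerm_base hcub hb)
  have e : ∀ i, 1 < i + 1 → i + 1 < 5 → f (M.facePerm^[i + 1] b) = f (M.facePerm^[i] b) + 1 ∧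
      s (M.facePerm^[i + 1] b).fst = -s (M.facePerm^[i] b).fst := fun i h1 h5 => by
    have h := hS.not_atCap_base_iterate hcub hb h1 h5
    have h' := hS.base_iterate hb (i := i) (by omega) (by omega)
    rw [Function.iterate_succ_apply'] at h ⊢
    exact ⟨hD.facePerm_of_not_atCap hcub h, hD.sign_facePerm h'.1 h'.2⟩
  have s1 : s (M.facePerm^[1] b).fst = s b.fst := hD.sign_base hb
  obtain ⟨e2, s2⟩ := e 1 (by omega) (by omega)
  obtain ⟨e3, s3⟩ := e 2 (by omega) (by omega)
  obtain ⟨e4, s4⟩ := e 3 (by omega) (by omega)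
  have h3 : (3 : ZMod 3) = 0 := by decide
  refine ⟨e1, by rw [e2, e1], by rw [e3, e2, e1]; ring, ?_, s1, by rw [s2, s1],
    by rw [s3, s2, s1, neg_neg], by rw [s4, s3, s2, s1, neg_neg]⟩
  rw [e4, e3, e2, e1]
  linear_combination h3

end IsDirection

end RotationSystem

/-! ### Equal directions of the caps, and the coloring of a drum -/

namespace RotationSystem

variable {V : Type*} {G : SimpleGraph V} {M : RotationSystem G}

/-- The two caps of a drum have the same direction: otherwise the signed number of edges pointing
in the direction of one of them would not be balanced. -/
theorem IsDirection.eq_of_caps [Finite V] {F F' : M.Face} {s : V → ℤ} {f : G.Dart → ZMod 3}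
    (hM : M.IsFullerene) (hS : M.IsCapSet fun d => M.faceOf d = F ∨ M.faceOf d = F')
    (hD : M.IsDirection (fun d => M.faceOf d = F ∨ M.faceOf d = F') s f) {d e : G.Dart}
    (hd : M.faceOf d = F) (he : M.faceOf e = F ∨ M.faceOf e = F') : f e = f d := by
  classical
  have hcub := hM.cubic
  set S : G.Dart → Prop := fun d => M.faceOf d = F ∨ M.faceOf d = F' with hSdef
  have hdS : S d := .inl hd
  have hsame : ∀ {x y : G.Dart}, S x → M.faceOf x = M.faceOf y →
      f y = f x ∧ s y.fst = s x.fst := fun {x y} hx hxy => by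
    obtain ⟨i, -, rfl⟩ := M.faceOf_eq_iff_exists.1 hxy
    exact hD.iterate_of_cap hS hcub hx i
  rcases he with he | he
  · exact (hsame hdS (hd.trans he.symm)).1
  by_contra hne
  have := Fintype.ofFinite G.Dart
  have := Fintype.ofFinite M.Face
  let χ : ZMod 3 → ℤ := fun x => if x = f e then 1 else 0
  let W : G.Dart → ℤ := fun x => if S x ∨ S x.symm then 0 else s x.fst * χ (f x)
  have hW0 : ∀ x, S x ∨ S x.symm → W x = 0 := fun x hx => if_pos hx
  have hW1 : ∀ x, ¬ S x ∧ ¬ S x.symm → W x = s x.fst * χ (f x) := fun x hx =>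
    if_neg (not_or.2 hx)
  have hWsum : ∑ x, W x = 0 := by
    have h1 : ∑ x, W x = ∑ x : G.Dart, W x.symm :=
      (Equiv.sum_comp (Function.Involutive.toPerm _ SimpleGraph.Dart.symm_involutive) W).symm
    have h2 : ∀ x : G.Dart, W x.symm = -W x := fun x => by
      by_cases hx : S x ∨ S x.symm
      · rw [hW0 x hx, hW0 x.symm (by rwa [SimpleGraph.Dart.symm_symm, or_comm]), neg_zero]
      · have hx' := not_or.1 hx
        rw [hW1 x hx', hW1 x.symm ⟨hx'.2, by rw [SimpleGraph.Dart.symm_symm]; exact hx'.1⟩,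
          hD.symm]
        change s x.snd * _ = _
        rw [hD.sign_neg x hx'.1 hx'.2]
        ring
    simp_rw [h2, Finset.sum_neg_distrib] at h1
    omega
  -- The two sides next to the base share its direction and have opposite signs, so only the two
  -- sides at the apex count.
  have hpent : ∀ b : G.Dart, S b.symm → ∑ x with M.faceOf x = M.faceOf b, W x
      = s b.symm.fst * (χ (f b.symm + 2) - χ (f b.symm + 1)) := fun b hb => by
    obtain ⟨f1, f2, f3, f4, s1, s2, s3, s4⟩ := hD.base_values hS hcub hb
    rw [M.sum_face, hS.base_five hb]
    simp only [Finset.sum_range_succ, Finset.sum_range_zero]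
    rw [hW0 (M.facePerm^[0] b) (.inr hb),
      hW1 _ (hS.base_iterate hb (i := 1) (by omega) (by omega)),
      hW1 _ (hS.base_iterate hb (i := 2) (by omega) (by omega)),
      hW1 _ (hS.base_iterate hb (i := 3) (by omega) (by omega)),
      hW1 _ (hS.base_iterate hb (i := 4) (by omega) (by omega)),
      f1, f2, f3, f4, s1, s2, s3, s4, hD.symm b, ← hD.sign_eq _ hb]
    simp only [SimpleGraph.Dart.symm_toProd, Prod.snd_swap]
    ring
  have hhex : ∀ x, M.faceLength (M.faceOf x) = 6 → ∑ y with M.faceOf y = M.faceOf x, W y = 0 :=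
      fun x h6 => by
    rw [M.sum_face, h6]
    by_cases hx : S x
    · exact Finset.sum_eq_zero fun i _ => hW0 _ (.inl ((hS.iterate_iff x i).2 hx))
    -- Opposite sides have equal directions and opposite signs, so they cancel.
    · have h3 : ((3 : ℕ) : ZMod 3) = 0 := by decide
      have h4 : ((4 : ℕ) : ZMod 3) = 1 := by decide
      have h5 : ((5 : ℕ) : ZMod 3) = 2 := by decide
      have hi := fun i => hD.iterate_of_hexagon hS hcub h6 hx i
      have hv : ∀ i, W (M.facePerm^[i] x) = (-1) ^ i * s x.fst * χ (f x + i) := fun i => by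
        rw [hW1 _ (hS.hexagon_iterate h6 hx i), (hi i).1, (hi i).2]
      simp only [Finset.sum_range_succ, Finset.sum_range_zero, hv, h3, h4, h5]
      simp only [Nat.cast_zero, Nat.cast_one, Nat.cast_ofNat]
      ring
  -- The contribution of each pentagon at the first cap. It is ±1 since exactly one of `f d + 1` and
  -- `f d + 2` equals `f e`.
  set τ : ℤ := s d.fst * (χ (f d + 2) - χ (f d + 1)) with hτ
  have hτ1 : τ * τ = 1 := by
    have key : ∀ x y : ZMod 3, x ≠ y → ((if y + 2 = x then 1 else 0) -
        (if y + 1 = x then 1 else 0) : ℤ) = 1 ∨ ((if y + 2 = x then 1 else 0) -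
        (if y + 1 = x then 1 else 0) : ℤ) = -1 := by decide
    have h1 := key _ _ hne
    change χ (f d + 2) - χ (f d + 1) = 1 ∨ χ (f d + 2) - χ (f d + 1) = -1 at h1
    rw [hτ]
    rcases h1 with h1 | h1 <;> rcases hD.sign d.fst with h2 | h2 <;> rw [h1, h2] <;> norm_num
  have hnonneg : ∀ A : M.Face, 0 ≤ τ * ∑ x with M.faceOf x = A, W x := fun A => by
    obtain ⟨x, rfl⟩ := M.faceOf_surjective A
    rcases hM.faceLength_eq (M.faceOf x) with h | h
    · obtain ⟨b, hb, hbS⟩ := hS.exists_base x h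
      rw [← hb, hpent b hbS]
      rcases hbS with h' | h'
      · obtain ⟨h1, h2⟩ := hsame hdS (hd.trans h'.symm)
        rw [h1, h2, ← hτ, hτ1]
        norm_num
      · obtain ⟨h1, -⟩ := hsame (.inr he) (he.trans h'.symm)
        have h2 : χ (f e + 2) - χ (f e + 1) = 0 := by
          have : (2 : ZMod 3) ≠ 0 := by decide
          simp [χ, this]
        rw [h1, h2]
        simp
    · rw [hhex x h, mul_zero]
  have htot : ∑ A : M.Face, τ * ∑ x with M.faceOf x = A, W x = 0 := by
    rw [← Finset.mul_sum,
      (Finset.sum_fiberwise Finset.univ M.faceOf W).trans hWsum, mul_zero]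
  have h0 := (Finset.sum_eq_zero_iff_of_nonneg fun A _ => hnonneg A).1 htot (M.faceOf d.symm)
    (Finset.mem_univ _)
  rw [hpent d.symm (by simpa using hdS), SimpleGraph.Dart.symm_symm, ← hτ, hτ1] at h0
  exact one_ne_zero h0

/-- If all caps have the same direction, the signed directions of the edges are the increments of
a coloring that is injective on neighborhoods. -/
theorem IsDirection.exists_nbrInjective [Finite V] {S : G.Dart → Prop} {s : V → ℤ}
    {f : G.Dart → ZMod 3} (hM : M.IsFullerene) (hS : M.IsCapSet S) (hD : M.IsDirection S s f)
    {a : ZMod 3} (ha : ∀ d, S d → f d = a) : ∃ c : V → ZMod 3, NbrInjective G c := by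
  classical
  have hcub := hM.cubic
  let t : V → ZMod 3 := fun v => s v
  have ht : ∀ v, t v ≠ 0 ∧ t v ≠ -t v := fun v => by
    simp only [t]
    rcases hD.sign v with h | h <;> rw [h] <;> decide
  -- Edges at a cap all have direction `a`, so the general formula would vanish on all three edges
  -- at a cap vertex; along the cap hexagon ± the sign replaces it.
  let α : G.Dart → ZMod 3 := fun d =>
    if S d then t d.fst else if S d.symm then -t d.fst else t d.fst * (f d - a)
  have α0 : ∀ d, S d → α d = t d.fst := fun d h => if_pos h
  have α1 : ∀ d, S d.symm → α d = -t d.fst := fun d h => by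
    have h' : ¬ S d := by simpa using hS.not_symm h
    simp only [α, if_neg h', if_pos h]
  have α2 : ∀ d, ¬ S d ∧ ¬ S d.symm → α d = t d.fst * (f d - a) := fun d h => by
    simp only [α, if_neg h.1, if_neg h.2]
  have hanti : ∀ d : G.Dart, α d.symm = -α d := fun d => by
    by_cases h : S d
    · rw [α0 d h, α1 d.symm (by simpa using h)]
      change -((s d.snd : ℤ) : ZMod 3) = _
      rw [hD.sign_eq d h]
    by_cases h' : S d.symm
    · rw [α0 _ h', α1 d h']
      have := hD.sign_eq _ h'
      simp only [SimpleGraph.Dart.symm_toProd, Prod.snd_swap, Prod.fst_swap, neg_neg, t] at this ⊢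
      rw [this]
    · rw [α2 d ⟨h, h'⟩, α2 d.symm ⟨h', by simpa using h⟩, hD.symm]
      change ((s d.snd : ℤ) : ZMod 3) * _ = _
      rw [hD.sign_neg d h h']
      simp only [t]
      push_cast
      ring
  have h3 : (3 : ZMod 3) = 0 := by decide
  have hsum := hS.sum_face_eq_zero hM α
    (fun d hd => by
      have : ∀ i, α (M.facePerm^[i] d) = t d.fst := fun i => by
        rw [α0 _ ((hS.iterate_iff d i).2 hd)]
        simp only [t, (hD.iterate_of_cap hS hcub hd i).2]
      simp only [this, Finset.sum_const, Finset.card_range]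
      generalize t d.fst = x
      revert x
      decide)
    (fun d h6 hd => by
      have : ∀ i, α (M.facePerm^[i] d) = (-1) ^ i * t d.fst * (f d + i - a) := fun i => by
        obtain ⟨h1, h2⟩ := hD.iterate_of_hexagon hS hcub h6 hd i
        rw [α2 _ (hS.hexagon_iterate h6 hd i), h1]
        simp only [t, h2]
        push_cast
        ring
      simp only [this, Finset.sum_range_succ, Finset.sum_range_zero]
      push_cast
      linear_combination (-t d.fst) * h3)
    -- Because the base has direction `a`, the increments are −t, 0, −t, 2t, 0 with t the sign of
    -- the tail of `b`.
    (fun b hb => by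
      obtain ⟨f1, f2, f3, f4, s1, s2, s3, s4⟩ := hD.base_values hS hcub hb
      simp only [Finset.sum_range_succ, Finset.sum_range_zero]
      have hfb : f b = a := by rw [← hD.symm, ha _ hb]
      rw [α1 (M.facePerm^[0] b) hb, α2 _ (hS.base_iterate hb (i := 1) (by omega) (by omega)),
        α2 _ (hS.base_iterate hb (i := 2) (by omega) (by omega)),
        α2 _ (hS.base_iterate hb (i := 3) (by omega) (by omega)),
        α2 _ (hS.base_iterate hb (i := 4) (by omega) (by omega)), f1, f2, f3, f4, hfb]
      simp only [t, s1, s2, s3, s4, Function.iterate_zero_apply]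
      push_cast
      ring)
  obtain ⟨c, hc⟩ := M.exists_potential hM.plane α hanti hsum
  have hside : ∀ d : G.Dart, S d.symm → α (M.facePerm d) = 0 := fun d hd => by
    rw [α2 (M.facePerm d) (hS.base_iterate hd (i := 1) (by omega) (by omega)),
      show f (M.facePerm d) = f d from (hD.base_values hS hcub hd).1, ← hD.symm, ha _ hd, sub_self, mul_zero]
  -- With t the sign of the vertex, the increments are t, −t and 0 at a cap vertex; elsewhere each
  -- rotation step adds t.
  have hrot : ∀ d, α d ≠ α (M.rot d) := fun d => by
    by_cases h : S d
    · rw [α0 d h, ← facePerm_symm, hside d.symm (by simpa using h)]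
      exact (ht _).1
    by_cases h' : S d.symm
    · rw [α1 d h', α0 _ ((hS.rot_iff d).2 h'), fst_rot]
      exact (ht _).2.symm
    by_cases h'' : S (M.rot (M.rot d))
    · have hd : M.facePerm (M.rot (M.rot d)).symm = d := M.facePerm_symm_rot_rot hcub d
      have h0 := hside (M.rot (M.rot d)).symm (by simpa using h'')
      rw [hd] at h0
      rw [h0, α1 _ ((hS.rot_iff _).1 h'')]
      exact (neg_ne_zero.2 (ht _).1).symm
    · have hcap : ¬ M.AtCap S d := not_or.2 ⟨h, not_or.2 ⟨fun h1 => h' ((hS.rot_iff d).1 h1), h''⟩⟩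
      rw [α2 d ⟨h, h'⟩, α2 (M.rot d) ⟨fun h1 => h' ((hS.rot_iff d).1 h1),
        fun h1 => h'' ((hS.rot_iff _).2 h1)⟩, fst_rot, hD.rot_of_not_atCap d hcap]
      intro heq
      refine (ht d.fst).1 ?_
      linear_combination -heq
  refine ⟨c, fun d e hde hne heq => ?_⟩
  have hα : α d = α e := by rw [hc d, hc e, hde, heq]
  rcases M.eq_or_eq_rot_of_fst_eq hcub hde with h | h | h
  · exact hne h.symm
  · exact hrot d (hα.trans (by rw [h]))
  · refine hrot e ?_
    rw [← hα, h, M.rot_rot_rot hcub]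

theorem IsDrum.exists_nbrInjective [Finite V] {k : ℕ} (h : M.IsDrum k) :
    ∃ c : V → Fin 3, NbrInjective G c := by
  obtain ⟨F, F', ⟨d, hd⟩, hS⟩ := h.exists_isCapSet
  obtain ⟨s, f, hD⟩ := hS.exists_isDirection h.1
  exact hD.exists_nbrInjective h.1 hS (a := f d) fun e he => hD.eq_of_caps h.1 hS hd he

end RotationSystem

theorem mainTheorem2 {V : Type*} [Finite V] (G : SimpleGraph V) (M : RotationSystem G)
    (hM : M.IsFullerene) :
    G.ExactSquareColorable 3 ↔ ∃ k : ℕ, 0 < k ∧ M.IsDrum k := by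
  rw [hM.exactSquareColorable_iff]
  exact ⟨fun ⟨_, hc⟩ => hM.exists_isDrum_of_nbrInjective hc,
    fun ⟨_, _, hk⟩ => hk.exists_nbrInjective⟩
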